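/- **Theorem 3.5.** Let $d,n$ be positive integers and $\mathbb F$ a field. A *staircase* is a set $\lambda\subseteq\mathbb N^d$ such that $u\le v\in\lambda$ (coordinatewise) implies $u\in\lambda$; let $V_n^d$ be the union of all $n$-element staircases in $\mathbb N^d$. Call an element of $V_n^d-V_n^d=\{u-v:u,v\in V_n^d\}$ *primitive* if it is not a nonnegative integer multiple of another element of $V_n^d-V_n^d$. Let $D_n^d$ be the set of primitive elements of $V_n^d-V_n^d$ if $n\ge 2$, and let $D_1^d:=\{\pm e_1,\dots,\pm e_d\}$. The *Hilbert zonotope* is the Minkowski sum of segments $\mathcal H_n^d:=\sum_{v\in D_n^d}[0,1]\cdot v\subset\mathbb R^d$. Let $\mathrm{Hilb}_n^d$ be the set of ideals $I$ of $\mathbb F[x]=\mathbb F[x_1,\dots,x_d]$ with $\dim_{\mathbb F}\mathbb F[x]/I=n$. For $I\in\mathrm{Hilb}_n^d$ let $\Gamma(I)$ be the set of $n$-element subsets $\lambda\subseteq V_n^d$ such that the classes modulo $I$ of the monomials $x^v$, $v\in\lambda$, form an $\mathbb F$-basis of $\mathbb F[x]/I$. Let $\mathcal B(I):=\mathrm{conv}\{\sum_{v\in\lambda}v:\lambda\in\Gamma(I)\}\subset\mathbb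 R^d$ be the *basis polytope* of $I$ and let $\mathcal S(I):=\mathcal B(I)+\mathbb R_{\ge 0}^d$ be its *state polyhedron*. For a polyhedron $P\subseteq\mathbb R^d$ and a nonempty face $G$ of $P$, the *normal cone* of $G$ at $P$ is the set of all $w\in\mathbb R^d$ for which $G$ is exactly the set of minimizers of $x\mapsto w\cdot x$ over $P$; the *normal fan* of $P$ is the collection of normal cones of all nonempty faces of $P$. A polyhedron $P$ is a *refinement* of a polyhedron $Q$ if the closure of each member of the normal fan of $Q$ is a union of closures of members of the normal fan of $P$. Then, for every $I\in\mathrm{Hilb}_n^d$, the Hilbert zonotope $\mathcal H_n^d$ is a refinement of both $\mathcal B(I)$ and $\mathcal S(I)$. -/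

import Mathlib

open scoped Pointwise

namespace HilbertZonotope

/-- The union of all `n`-element staircases (finite lower sets) in `ℕ^d`. -/
def stairUnion (d n : ℕ) : Set (Fin d →₀ ℕ) :=
  {v | ∃ l : Finset (Fin d →₀ ℕ), IsLowerSet (l : Set (Fin d →₀ ℕ)) ∧ l.card = n ∧ v ∈ l}

theorem stairUnion_finite (d n : ℕ) : (stairUnion d n).Finite := by
  refine (Set.finite_Icc (0 : Fin d →₀ ℕ)
    (Finsupp.equivFunOnFinite.symm (fun _ => n))).subset ?_
  rintro v ⟨l, hl, hc, hv⟩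
  refine ⟨zero_le, fun i => ?_⟩
  have hsub : (Finset.range (v i + 1)).image (fun k => Finsupp.single i k) ⊆ l := by
    intro x hx
    obtain ⟨k, hk, rfl⟩ := Finset.mem_image.1 hx
    refine hl ?_ hv
    rw [Finsupp.single_le_iff]
    exact Nat.lt_succ_iff.1 (Finset.mem_range.1 hk)
  have h := Finset.card_le_card hsub
  rw [Finset.card_image_of_injective _ (Finsupp.single_injective i), Finset.card_range, hc] at h
  simpa using (Nat.le_of_succ_le h)

/-- The symmetrization `{u - v : u, v ∈ V}` of the union `V` of all `n`-staircases. -/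
def stairDiff (d n : ℕ) : Set (Fin d → ℤ) :=
  Set.image2 (fun u v i => (u i : ℤ) - (v i : ℤ)) (stairUnion d n) (stairUnion d n)

/-- An element of the symmetrization is primitive if it is not a nonnegative integer multiple
of another element of the symmetrization. -/
def IsPrimitiveDiff (d n : ℕ) (x : Fin d → ℤ) : Prop :=
  x ∈ stairDiff d n ∧ ∀ y ∈ stairDiff d n, y ≠ x → ∀ k : ℕ, x ≠ k • y

/-- The direction set: `± e_1, …, ± e_d` for `n = 1`, and the primitive elements of the
symmetrization otherwise. -/
def directions (d n : ℕ) : Set (Fin d → ℤ) :=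
  if n = 1 then {x | ∃ i : Fin d, x = Pi.single i 1 ∨ x = -Pi.single i 1}
  else {x | IsPrimitiveDiff d n x}

theorem directions_finite (d n : ℕ) : (directions d n).Finite := by
  unfold directions
  split_ifs
  · refine ((Set.finite_range (fun i : Fin d => (Pi.single i 1 : Fin d → ℤ))).union
      (Set.finite_range (fun i : Fin d => (-Pi.single i 1 : Fin d → ℤ)))).subset ?_
    rintro x ⟨i, rfl | rfl⟩
    · exact Or.inl ⟨i, rfl⟩
    · exact Or.inr ⟨i, rfl⟩
  · exact (((stairUnion_finite d n).image2 _ (stairUnion_finite d n))).subset fun x hx => hx.1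

/-- The Hilbert zonotope: the Minkowski sum of the segments `[0, 1] · v` over all directions
`v`. -/
noncomputable def hilbertZonotope (d n : ℕ) : Set (Fin d → ℝ) :=
  ∑ v ∈ (directions_finite d n).toFinset, segment ℝ 0 (fun i => (v i : ℝ))

/-- The set of ideals of length `n` in the polynomial ring in `d` variables over `F`. -/
def hilb (F : Type*) [Field F] (d n : ℕ) : Set (Ideal (MvPolynomial (Fin d) F)) :=
  {I | Module.Finite F (MvPolynomial (Fin d) F ⧸ I) ∧
    Module.finrank F (MvPolynomial (Fin d) F ⧸ I) = n}

/-- A finite set `l` of exponents is basic for `I` if the classes modulo `I` of the monomials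
`x^v`, `v ∈ l`, form a vector space basis of the quotient by `I`. -/
def IsBasic {F : Type*} [Field F] {d : ℕ} (I : Ideal (MvPolynomial (Fin d) F))
    (l : Finset (Fin d →₀ ℕ)) : Prop :=
  LinearIndependent F
      (fun v : l => Ideal.Quotient.mk I (MvPolynomial.monomial (v : Fin d →₀ ℕ) (1 : F))) ∧
    Submodule.span F (Set.range
      (fun v : l => Ideal.Quotient.mk I (MvPolynomial.monomial (v : Fin d →₀ ℕ) (1 : F)))) = ⊤

/-- The `n`-subsets of the union of all `n`-staircases which are basic for `I`. -/
def basicSets {F : Type*} [Field F] {d : ℕ} (n : ℕ) (I : Ideal (MvPolynomial (Fin d) F)) :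
    Set (Finset (Fin d →₀ ℕ)) :=
  {l | l.card = n ∧ (l : Set (Fin d →₀ ℕ)) ⊆ stairUnion d n ∧ IsBasic I l}

/-- The vector sum of a finite set of exponents, as a point of `ℝ^d`. -/
def vectorSum {d : ℕ} (l : Finset (Fin d →₀ ℕ)) : Fin d → ℝ :=
  fun i => ∑ v ∈ l, (v i : ℝ)

/-- The basis polytope of `I`. -/
def basisPolytope {F : Type*} [Field F] {d : ℕ} (n : ℕ)
    (I : Ideal (MvPolynomial (Fin d) F)) : Set (Fin d → ℝ) :=
  convexHull ℝ (vectorSum '' basicSets n I)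

/-- The state polyhedron of `I`: the Minkowski sum of the basis polytope and the nonnegative
orthant. -/
def statePolyhedron {F : Type*} [Field F] {d : ℕ} (n : ℕ)
    (I : Ideal (MvPolynomial (Fin d) F)) : Set (Fin d → ℝ) :=
  basisPolytope n I + {x : Fin d → ℝ | ∀ i, 0 ≤ x i}

/-- The set of points of `P` at which the linear functional `w` is minimized over `P`
(empty if the minimum is not attained). -/
def minFace {d : ℕ} (P : Set (Fin d → ℝ)) (w : Fin d → ℝ) : Set (Fin d → ℝ) :=
  {x | x ∈ P ∧ ∀ y ∈ P, w ⬝ᵥ x ≤ w ⬝ᵥ y}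

/-- The (nonempty) faces of `P`; taking `w = 0` shows that `P` is one of them. -/
def IsFace {d : ℕ} (P G : Set (Fin d → ℝ)) : Prop :=
  G.Nonempty ∧ ∃ w, minFace P w = G

/-- The minimizing, relatively open normal cone of a face `G` of `P`: all `w` whose set of
minimizers over `P` is exactly `G`. -/
def normalCone {d : ℕ} (P G : Set (Fin d → ℝ)) : Set (Fin d → ℝ) :=
  {w | minFace P w = G}

/-- The normal fan of `P`: the collection of normal cones of all faces of `P`. -/
def normalFan {d : ℕ} (P : Set (Fin d → ℝ)) : Set (Set (Fin d → ℝ)) :=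
  {C | ∃ G, IsFace P G ∧ C = normalCone P G}

/-- `P` is a refinement of `Q`: the closure of each normal cone of `Q` is the union of closures
of normal cones of `P`. -/
def IsRefinement {d : ℕ} (P Q : Set (Fin d → ℝ)) : Prop :=
  ∀ C ∈ normalFan Q, ∃ K ⊆ normalFan P, closure C = ⋃ N ∈ K, closure N

end HilbertZonotope

/-! The closure of a normal cone consists of the functionals minimized on the whole face. Refinement
therefore reduces (`isRefinement_of_minFace`) to an implication: if `w` and `w'` select the same
face of the zonotope, then every minimizer of `w` over the other polyhedron is a minimizer of `w'`.

The zonotope face of `w` controls the signs of `w` on the directions. Every nonzero difference of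
exponents is a positive multiple of a direction when `n ≠ 1`, so these signs fix the weak order by
`w`-weight on the union of staircases; they also fix the signs of the coordinates of `w`
(`compare_of_directions`).

As for matroids, this order alone decides which bases have minimal weight. A bijection between two
bases, each pair of which is a valid exchange in the first (`exists_exchange`), turns global
minimality into termwise comparisons of single weights (`minimal_basicSet`). Passing to the convex
hull gives the basis polytope; the coordinate signs handle the orthant summand of the state
polyhedron. -/

namespace HilbertZonotope

open Filter Topology

/-! ### Normal cones and a criterion for refinement -/

section NormalFan

variable {d : ℕ}

/-- The closure of the normal cone of a face consists of the functionals minimized on that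
face. -/
theorem closure_normalCone {Q : Set (Fin d → ℝ)} {w₀ : Fin d → ℝ}
    (hne : (minFace Q w₀).Nonempty) :
    closure (normalCone Q (minFace Q w₀)) = {w | minFace Q w₀ ⊆ minFace Q w} := by
  apply Set.Subset.antisymm
  · intro w hw x hx
    refine ⟨hx.1, fun y hy => ?_⟩
    have hcl : IsClosed {w : Fin d → ℝ | w ⬝ᵥ x ≤ w ⬝ᵥ y} := by
      apply isClosed_le <;> · unfold dotProduct; fun_prop
    refine closure_minimal ?_ hcl hw
    intro u hu
    have hu' : minFace Q u = minFace Q w₀ := hu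
    rw [← hu'] at hx
    exact hx.2 y hy
  · intro w hw
    have hw' : minFace Q w₀ ⊆ minFace Q w := hw
    -- Perturbing `w` slightly towards `w₀` breaks ties exactly as `w₀` does, so `w` is a limit of
    -- points of the open cone.
    have hmem : ∀ ε : ℝ, 0 < ε → minFace Q (w + ε • w₀) = minFace Q w₀ := by
      intro ε hε
      apply Set.Subset.antisymm
      · obtain ⟨x, hx⟩ := hne
        intro y hy
        have h1 := hy.2 x hx.1
        have h2 := (hw' hx).2 y hy.1
        simp only [add_dotProduct, smul_dotProduct, smul_eq_mul] at h1
        have h3 : w₀ ⬝ᵥ y ≤ w₀ ⬝ᵥ x := by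
          refine le_of_mul_le_mul_left ?_ hε
          linarith
        exact ⟨hy.1, fun z hz => h3.trans (hx.2 z hz)⟩
      · intro x hx
        refine ⟨hx.1, fun y hy => ?_⟩
        simp only [add_dotProduct, smul_dotProduct, smul_eq_mul]
        exact add_le_add ((hw' hx).2 y hy) (mul_le_mul_of_nonneg_left (hx.2 y hy) hε.le)
    have hlim : Tendsto (fun ε : ℝ => w + ε • w₀) (𝓝[>] 0) (𝓝 w) := by
      have hc : Continuous fun ε : ℝ => w + ε • w₀ := by fun_prop
      have := hc.tendsto 0
      simp only [zero_smul, add_zero] at this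
      exact this.mono_left nhdsWithin_le_nhds
    exact mem_closure_of_tendsto hlim
      (eventually_nhdsWithin_of_forall fun ε hε => hmem ε hε)

/-- A set `P` on which every functional attains its minimum is a refinement of `Q` if functionals
with the same minimizers over `P` have the same minimizers over `Q`. -/
theorem isRefinement_of_minFace {P Q : Set (Fin d → ℝ)}
    (hP : ∀ w, (minFace P w).Nonempty)
    (h : ∀ w w', minFace P w = minFace P w' → minFace Q w ⊆ minFace Q w') :
    IsRefinement P Q := by
  rintro C ⟨G, ⟨hne, w₀, rfl⟩, rfl⟩
  -- All cones of `P` inside the closed cone are taken; they cover it because the `P`-cone of each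
  -- `w` in it stays inside, by `h`.
  refine ⟨{N | N ∈ normalFan P ∧ N ⊆ closure (normalCone Q (minFace Q w₀))},
    fun N hN => hN.1, ?_⟩
  apply Set.Subset.antisymm
  · intro w hw
    refine Set.mem_biUnion (x := normalCone P (minFace P w)) ⟨⟨_, ⟨hP w, w, rfl⟩, rfl⟩, ?_⟩
      (subset_closure rfl)
    intro w' hw'
    rw [closure_normalCone hne] at hw ⊢
    have hw'' : minFace P w' = minFace P w := hw'
    exact Set.Subset.trans hw (h w w' hw''.symm)
  · refine Set.iUnion₂_subset fun N hN => ?_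
    exact closure_minimal hN.2 isClosed_closure

end NormalFan

/-! ### Faces of a zonotope and signs on its generators -/

section Zonotope

variable {d : ℕ} (D : Finset (Fin d → ℤ))

/-- A partial sum of generators is a minimizer over a zonotope exactly when the functional is
nonpositive on the generators used and nonnegative on the others. -/
theorem sum_mem_minFace_zonotope (T : Finset (Fin d → ℤ)) (w : Fin d → ℝ) :
    (∑ v ∈ D, if v ∈ T then (fun i => (v i : ℝ)) else 0) ∈
        minFace (∑ v ∈ D, segment ℝ 0 (fun i => (v i : ℝ))) w ↔
      ∀ v ∈ D, (v ∈ T → w ⬝ᵥ (fun i => (v i : ℝ)) ≤ 0) ∧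
        (v ∉ T → 0 ≤ w ⬝ᵥ (fun i => (v i : ℝ))) := by
  classical
  have hpt : ∀ T : Finset (Fin d → ℤ),
      (∑ v ∈ D, if v ∈ T then (fun i => (v i : ℝ)) else 0) ∈
        ∑ v ∈ D, segment ℝ 0 (fun i => (v i : ℝ)) := by
    intro T
    refine Set.finsetSum_mem_finsetSum _ _ _ fun v _ => ?_
    split_ifs
    · exact right_mem_segment ℝ _ _
    · exact left_mem_segment ℝ _ _
  constructor
  · intro h v hv
    constructor
    · intro hvT
      -- Toggling `v` in `T` changes the value by `w ⬝ᵥ v` up to sign, so minimality gives the sign.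
      have := h.2 _ (hpt (T.erase v))
      rw [← Finset.add_sum_erase _ _ hv, ← Finset.add_sum_erase _ _ hv] at this
      have hs : (∑ x ∈ D.erase v, if x ∈ T.erase v then (fun i => (x i : ℝ)) else 0) =
          ∑ x ∈ D.erase v, if x ∈ T then (fun i => (x i : ℝ)) else 0 := by
        refine Finset.sum_congr rfl fun x hx => ?_
        simp [Finset.ne_of_mem_erase hx]
      rw [hs] at this
      simp [hvT, dotProduct_add] at this
      exact this
    · intro hvT
      have := h.2 _ (hpt (insert v T))
      rw [← Finset.add_sum_erase _ _ hv, ← Finset.add_sum_erase _ _ hv] at this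
      have hs : (∑ x ∈ D.erase v, if x ∈ insert v T then (fun i => (x i : ℝ)) else 0) =
          ∑ x ∈ D.erase v, if x ∈ T then (fun i => (x i : ℝ)) else 0 := by
        refine Finset.sum_congr rfl fun x hx => ?_
        simp [Finset.ne_of_mem_erase hx]
      rw [hs] at this
      simp [hvT, dotProduct_add] at this
      exact this
  · intro h
    refine ⟨hpt T, fun y hy => ?_⟩
    obtain ⟨g, hg, rfl⟩ := (Set.mem_finsetSum _ _ _).1 hy
    rw [dotProduct_sum, dotProduct_sum]
    refine Finset.sum_le_sum fun v hv => ?_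
    obtain ⟨a, b, ha, hb, hab, hgv⟩ := hg hv
    rw [← hgv]
    simp only [smul_zero, zero_add, dotProduct_smul, smul_eq_mul]
    split_ifs with hT
    · nlinarith [(h v hv).1 hT]
    · simpa using mul_nonneg hb ((h v hv).2 hT)

theorem minFace_zonotope_nonempty (w : Fin d → ℝ) :
    (minFace (∑ v ∈ D, segment ℝ 0 (fun i => (v i : ℝ))) w).Nonempty := by
  classical
  refine ⟨_, (sum_mem_minFace_zonotope D
    (D.filter fun v => w ⬝ᵥ (fun i => (v i : ℝ)) ≤ 0) w).2 fun v hv => ?_⟩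
  simp only [Finset.mem_filter, hv, true_and]
  exact ⟨id, fun h => (not_le.1 h).le⟩

/-- Functionals with the same minimizers over a zonotope are nonpositive on the same
generators. -/
theorem nonpos_of_minFace_zonotope_eq {w w' : Fin d → ℝ}
    (h : minFace (∑ v ∈ D, segment ℝ 0 (fun i => (v i : ℝ))) w =
      minFace (∑ v ∈ D, segment ℝ 0 (fun i => (v i : ℝ))) w') {v : Fin d → ℤ} (hv : v ∈ D)
    (hw : w ⬝ᵥ (fun i => (v i : ℝ)) ≤ 0) : w' ⬝ᵥ (fun i => (v i : ℝ)) ≤ 0 := by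
  classical
  have key := (sum_mem_minFace_zonotope D
    (D.filter fun v => w ⬝ᵥ (fun i => (v i : ℝ)) ≤ 0) w).2 fun u hu => by
      simp only [Finset.mem_filter, hu, true_and]
      exact ⟨id, fun h => (not_le.1 h).le⟩
  rw [h, sum_mem_minFace_zonotope] at key
  exact (key v hv).1 (Finset.mem_filter.2 ⟨hv, hw⟩)

end Zonotope

/-! ### From signs on directions to the order on exponents -/

section Directions

variable {d n : ℕ}

/-- The staircase of the first `n` points on a coordinate axis contains both. -/
theorem zero_mem_stairUnion (hd : 0 < d) (hn : 0 < n) : (0 : Fin d →₀ ℕ) ∈ stairUnion d n ∧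
    ∀ i : Fin d, 2 ≤ n → Finsupp.single i 1 ∈ stairUnion d n := by
  have key : ∀ i : Fin d, ∃ l : Finset (Fin d →₀ ℕ), IsLowerSet (l : Set (Fin d →₀ ℕ)) ∧
      l.card = n ∧ ∀ k < n, Finsupp.single i k ∈ l := by
    intro i
    refine ⟨(Finset.range n).image fun k => Finsupp.single i k, ?_, ?_, ?_⟩
    · intro u v hvu hu
      simp only [Finset.coe_image, Set.mem_image, Finset.mem_coe, Finset.mem_range] at hu ⊢
      obtain ⟨k, hk, rfl⟩ := hu
      refine ⟨v i, ?_, ?_⟩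
      · have := hvu i
        simp only [Finsupp.single_eq_same] at this
        omega
      · ext j
        by_cases hj : j = i
        · subst hj; simp
        · have := hvu j
          rw [Finsupp.single_eq_of_ne hj] at this ⊢
          omega
    · rw [Finset.card_image_of_injective _ (Finsupp.single_injective i), Finset.card_range]
    · intro k hk
      exact Finset.mem_image_of_mem _ (Finset.mem_range.2 hk)
  constructor
  · obtain ⟨l, h1, h2, h3⟩ := key ⟨0, hd⟩
    exact ⟨l, h1, h2, by simpa using h3 0 hn⟩
  · intro i h
    obtain ⟨l, h1, h2, h3⟩ := key i
    exact ⟨l, h1, h2, h3 1 (by omega)⟩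

theorem stairUnion_one {v : Fin d →₀ ℕ} (hv : v ∈ stairUnion d 1) : v = 0 := by
  obtain ⟨l, hl, hc, hv⟩ := hv
  exact Finset.card_le_one.1 hc.le _ hv _ (hl zero_le hv)

/-- Every nonzero difference is a natural multiple of a primitive one. -/
theorem exists_primitive {x : Fin d → ℤ} (hx : x ∈ stairDiff d n) (hx0 : x ≠ 0) :
    ∃ y, IsPrimitiveDiff d n y ∧ ∃ k : ℕ, x = k • y := by
  -- Induction on the ℓ¹-norm: a nonprimitive `x` is `k • y` with `k ≥ 2`, so `y` has smaller norm.
  induction hm : ∑ i, (x i).natAbs using Nat.strong_induction_on generalizing x with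
  | _ m ih =>
    by_cases hp : IsPrimitiveDiff d n x
    · exact ⟨x, hp, 1, by simp⟩
    · have : ∃ y ∈ stairDiff d n, y ≠ x ∧ ∃ k : ℕ, x = k • y := by
        by_contra hcon
        push Not at hcon
        exact hp ⟨hx, hcon⟩
      obtain ⟨y, hy, hyx, k, hk⟩ := this
      have hy0 : y ≠ 0 := by
        rintro rfl
        exact hx0 (by simpa using hk)
      have hk2 : 2 ≤ k := by
        by_contra hlt
        have : k = 0 ∨ k = 1 := by omega
        rcases this with rfl | rfl
        · exact hx0 (by simpa using hk)
        · exact hyx (by simpa using hk.symm)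
      have hpos : 0 < ∑ i, (y i).natAbs := by
        obtain ⟨i, hi⟩ := Function.ne_iff.1 hy0
        exact Finset.sum_pos' (fun _ _ => Nat.zero_le _)
          ⟨i, Finset.mem_univ i, Int.natAbs_pos.2 hi⟩
      have hsum : m = k * ∑ i, (y i).natAbs := by
        rw [← hm, hk, Finset.mul_sum]
        simp [Int.natAbs_mul]
      obtain ⟨z, hz, j, hj⟩ := ih _ (by nlinarith) hy hy0 rfl
      exact ⟨z, hz, k * j, by rw [hk, hj, mul_smul]⟩

/-- Nonpositivity on the directions transfers to nonpositivity on all differences. -/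
theorem nonpos_of_mem_stairDiff {w w' : Fin d → ℝ} (hn : n ≠ 1)
    (h : ∀ v ∈ directions d n,
      w ⬝ᵥ (fun i => (v i : ℝ)) ≤ 0 → w' ⬝ᵥ (fun i => (v i : ℝ)) ≤ 0)
    {x : Fin d → ℤ} (hx : x ∈ stairDiff d n) (hw : w ⬝ᵥ (fun i => (x i : ℝ)) ≤ 0) :
    w' ⬝ᵥ (fun i => (x i : ℝ)) ≤ 0 := by
  by_cases hx0 : x = 0
  · subst hx0
    simp [dotProduct]
  · obtain ⟨y, hy, k, rfl⟩ := exists_primitive hx hx0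
    have hk : 0 < k := Nat.pos_of_ne_zero fun h0 => hx0 (by simp [h0])
    have e : (fun i => ((k • y) i : ℝ)) = (k : ℝ) • fun i => (y i : ℝ) := by
      ext i; simp
    have hk' : (0 : ℝ) < k := by exact_mod_cast hk
    rw [e, dotProduct_smul, smul_eq_mul] at hw ⊢
    have hyd : y ∈ directions d n := by
      rw [directions, if_neg hn]
      exact hy
    have := h y hyd (nonpos_of_mul_nonpos_right hw hk')
    exact mul_nonpos_of_nonneg_of_nonpos hk'.le this

/-- The ordering induced on the union of staircases, and the signs of the coordinates, only depend
on the signs on the directions. -/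
theorem compare_of_directions {w w' : Fin d → ℝ} (hd : 0 < d) (hn : 0 < n)
    (h : ∀ v ∈ directions d n,
      w ⬝ᵥ (fun i => (v i : ℝ)) ≤ 0 → w' ⬝ᵥ (fun i => (v i : ℝ)) ≤ 0) :
    (∀ u ∈ stairUnion d n, ∀ v ∈ stairUnion d n,
      w ⬝ᵥ (fun i => (u i : ℝ)) ≤ w ⬝ᵥ (fun i => (v i : ℝ)) →
      w' ⬝ᵥ (fun i => (u i : ℝ)) ≤ w' ⬝ᵥ (fun i => (v i : ℝ))) ∧
    ∀ i, (w i ≤ 0 → w' i ≤ 0) ∧ (0 ≤ w i → 0 ≤ w' i) := by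
  by_cases h1 : n = 1
  · subst h1
    constructor
    · intro u hu v hv _
      rw [stairUnion_one hu, stairUnion_one hv]
    · have e : ∀ (w : Fin d → ℝ) (i : Fin d),
          w ⬝ᵥ (fun j => (((Pi.single i 1 : Fin d → ℤ) j : ℤ) : ℝ)) = w i := by
        intro w i
        simp [dotProduct, Pi.single_apply]
      have e' : ∀ (w : Fin d → ℝ) (i : Fin d),
          w ⬝ᵥ (fun j => (((-Pi.single i 1 : Fin d → ℤ) j : ℤ) : ℝ)) = -w i := by
        intro w i
        simp [dotProduct, Pi.single_apply]
      intro i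
      constructor
      · have := h (Pi.single i 1) (by rw [directions, if_pos rfl]; exact ⟨i, Or.inl rfl⟩)
        rwa [e, e] at this
      · have := h (-Pi.single i 1) (by rw [directions, if_pos rfl]; exact ⟨i, Or.inr rfl⟩)
        rw [e', e'] at this
        intro hw
        linarith [this (by linarith)]
  · have key : ∀ u ∈ stairUnion d n, ∀ v ∈ stairUnion d n,
        w ⬝ᵥ (fun i => (u i : ℝ)) ≤ w ⬝ᵥ (fun i => (v i : ℝ)) →
        w' ⬝ᵥ (fun i => (u i : ℝ)) ≤ w' ⬝ᵥ (fun i => (v i : ℝ)) := by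
      intro u hu v hv huv
      have e : ∀ w : Fin d → ℝ, w ⬝ᵥ (fun i => (((u i : ℤ) - (v i : ℤ) : ℤ) : ℝ)) =
          w ⬝ᵥ (fun i => (u i : ℝ)) - w ⬝ᵥ (fun i => (v i : ℝ)) := by
        intro w
        rw [← dotProduct_sub]
        congr 1
        ext i
        simp
      have := nonpos_of_mem_stairDiff h1 h ⟨u, hu, v, hv, rfl⟩
        (by rw [e]; exact sub_nonpos.2 huv)
      rw [e] at this
      exact sub_nonpos.1 this
    refine ⟨key, fun i => ?_⟩
    -- Since `n ≥ 2`, comparing `e_i` with `0` in both directions reads off the sign of `w i`.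
    obtain ⟨h0, hs⟩ := zero_mem_stairUnion hd hn
    have hs := hs i (by omega)
    have e : ∀ (w : Fin d → ℝ),
        w ⬝ᵥ (fun j => ((Finsupp.single i 1 : Fin d →₀ ℕ) j : ℝ)) = w i := by
      intro w
      simp [dotProduct, Finsupp.single_apply]
    have e0 : ∀ (w : Fin d → ℝ), w ⬝ᵥ (fun j => ((0 : Fin d →₀ ℕ) j : ℝ)) = 0 := by
      intro w
      simp [dotProduct]
    have k1 := key _ hs _ h0
    have k2 := key _ h0 _ hs
    rw [e, e, e0, e0] at k1 k2
    exact ⟨k1, k2⟩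

end Directions

/-! ### Basis exchange and minimal-weight basic sets -/

section Exchange

variable {F : Type*} [Field F] {d n : ℕ} {I : Ideal (MvPolynomial (Fin d) F)}

/-- Simultaneous exchange: two finite bases contained in a family of vectors are related by a
bijection each of whose pairs can be exchanged in the first basis. -/
theorem exists_exchange {ι M : Type*} [DecidableEq ι] [AddCommGroup M] [Module F M]
    (m : ι → M) {s t : Finset ι} (hc : s.card = t.card)
    (hs : LinearIndependent F (fun v : s => m v))
    (hs' : Submodule.span F (Set.range fun v : s => m v) = ⊤)
    (ht : LinearIndependent F (fun v : t => m v))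
    (ht' : Submodule.span F (Set.range fun v : t => m v) = ⊤) :
    ∃ e : t ≃ s, ∀ v : t, (v : ι) = e v ∨ ((v : ι) ∉ s ∧
      LinearIndependent F
        (fun x : (insert (v : ι) (s.erase (e v)) : Finset ι) => m x) ∧
      Submodule.span F (Set.range
        fun x : (insert (v : ι) (s.erase (e v)) : Finset ι) => m x) = ⊤) := by
  classical
  let b : Module.Basis s F M := Module.Basis.mk hs hs'.ge
  have hb : ∀ u : s, b u = m u := fun u => by simp [b]
  -- An arbitrary bijection, used only to make the change-of-basis matrix square.
  have e₀ : t ≃ s := Finset.equivOfCardEq hc.symm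
  have hdet : IsUnit (b.det fun u : s => m (e₀.symm u)) := by
    rw [← Module.Basis.is_basis_iff_det b]
    refine ⟨ht.comp _ e₀.symm.injective, ?_⟩
    rw [← ht']
    congr 1
    exact e₀.symm.surjective.range_comp fun v : t => m v
  have hne : (b.toMatrix fun u : s => m (e₀.symm u)).det ≠ 0 := by
    rw [← Module.Basis.det_apply]
    exact hdet.ne_zero
  rw [Matrix.det_apply] at hne
  -- A nonzero term of the Leibniz expansion is a permutation along which every matrix entry is
  -- nonzero.
  obtain ⟨σ, -, hσ⟩ := Finset.exists_ne_zero_of_sum_ne_zero hne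
  have hprod : ∀ u, b.repr (m (e₀.symm u)) (σ u) ≠ 0 := by
    intro u h0
    apply hσ
    rw [Finset.prod_eq_zero (Finset.mem_univ u), smul_zero]
    simpa [Module.Basis.toMatrix_apply] using h0
  refine ⟨e₀.trans σ, fun v => ?_⟩
  have hv : b.repr (m v) (σ (e₀ v)) ≠ 0 := by simpa using hprod (e₀ v)
  generalize hu : (e₀.trans σ) v = u
  have hvu : b.repr (m v) u ≠ 0 := by
    rw [← hu]
    exact hv
  by_cases hvs : (v : ι) ∈ s
  · left
    have : m v = b ⟨v, hvs⟩ := (hb ⟨v, hvs⟩).symm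
    rw [this, Module.Basis.repr_self, Finsupp.single_apply] at hvu
    by_contra hcon
    exact hvu (if_neg fun h => hcon (by rw [← h]))
  · right
    have hli : LinearIndepOn F m (insert (v : ι) (s.erase (u : ι) : Finset ι) : Set ι) := by
      refine LinearIndepOn.insert ?_ ?_
      · exact LinearIndepOn.mono (show LinearIndepOn F m (s : Set ι) from hs)
          (by exact_mod_cast Finset.erase_subset _ _)
      · intro hmem
        -- The `u`-coordinate vanishes on the span of the remaining basis vectors but not at `m v`.
        have hle : Submodule.span F (m '' ((s.erase (u : ι) : Finset ι) : Set ι)) ≤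
            LinearMap.ker (b.coord u) := by
          rw [Submodule.span_le]
          rintro _ ⟨x, hx, rfl⟩
          have hx' := Finset.mem_erase.1 (Finset.mem_coe.1 hx)
          have : m x = b ⟨x, hx'.2⟩ := (hb ⟨x, hx'.2⟩).symm
          simp only [SetLike.mem_coe, LinearMap.mem_ker, Module.Basis.coord_apply]
          rw [this, Module.Basis.repr_self, Finsupp.single_apply,
            if_neg fun h => hx'.1 (by rw [← h])]
        exact hvu (hle hmem)
    have hli' : LinearIndependent F
        (fun x : (insert (v : ι) (s.erase (u : ι)) : Finset ι) => m x) := by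
      rw [← Finset.coe_insert] at hli
      exact hli
    refine ⟨hvs, hli', ?_⟩
    have : Module.Finite F M := Module.Finite.of_basis b
    refine hli'.span_eq_top_of_card_eq_finrank' ?_
    rw [Module.finrank_eq_card_basis b, Fintype.card_coe, Fintype.card_coe,
      Finset.card_insert_of_notMem (fun h => hvs (Finset.mem_of_mem_erase h)),
      Finset.card_erase_of_mem u.2]
    have := Finset.card_pos.2 ⟨_, u.2⟩
    omega

theorem dotProduct_vectorSum (w : Fin d → ℝ) (l : Finset (Fin d →₀ ℕ)) :
    w ⬝ᵥ vectorSum l = ∑ v ∈ l, w ⬝ᵥ (fun i => (v i : ℝ)) := by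
  rw [← dotProduct_sum]
  congr 1
  ext i
  simp [vectorSum]

/-- A basic set of minimal weight stays so as long as the ordering of the weights of the exponents
is preserved. -/
theorem minimal_basicSet {w w' : Fin d → ℝ}
    (h : ∀ u ∈ stairUnion d n, ∀ v ∈ stairUnion d n,
      w ⬝ᵥ (fun i => (u i : ℝ)) ≤ w ⬝ᵥ (fun i => (v i : ℝ)) →
      w' ⬝ᵥ (fun i => (u i : ℝ)) ≤ w' ⬝ᵥ (fun i => (v i : ℝ)))
    {s t : Finset (Fin d →₀ ℕ)} (hs : s ∈ basicSets n I)
    (hmin : ∀ l ∈ basicSets n I, w ⬝ᵥ vectorSum s ≤ w ⬝ᵥ vectorSum l)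
    (ht : t ∈ basicSets n I) : w' ⬝ᵥ vectorSum s ≤ w' ⬝ᵥ vectorSum t := by
  classical
  obtain ⟨e, he⟩ := exists_exchange
    (fun v : Fin d →₀ ℕ => Ideal.Quotient.mk I (MvPolynomial.monomial v (1 : F)))
    (hs.1.trans ht.1.symm) hs.2.2.1 hs.2.2.2 ht.2.2.1 ht.2.2.2
  have hle : ∀ v : t, w' ⬝ᵥ (fun i => ((e v : Fin d →₀ ℕ) i : ℝ)) ≤
      w' ⬝ᵥ (fun i => ((v : Fin d →₀ ℕ) i : ℝ)) := by
    intro v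
    rcases he v with hv | ⟨hvs, hli, hsp⟩
    · rw [← hv]
    · refine h _ (hs.2.1 (e v).2) _ (ht.2.1 v.2) ?_
      have hve : (v : Fin d →₀ ℕ) ∉ s.erase (e v) := fun h => hvs (Finset.mem_of_mem_erase h)
      -- The exchanged set is again basic, so minimality of `s` says that `e v` weighs at most `v`
      -- under `w`.
      have := hmin (insert (v : Fin d →₀ ℕ) (s.erase (e v))) ⟨?_, ?_, hli, hsp⟩
      · rw [dotProduct_vectorSum, dotProduct_vectorSum, Finset.sum_insert hve,
          ← Finset.add_sum_erase _ _ (e v).2] at this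
        exact le_of_add_le_add_right this
      · rw [Finset.card_insert_of_notMem hve, Finset.card_erase_of_mem (e v).2, ← hs.1]
        have := Finset.card_pos.2 ⟨_, (e v).2⟩
        omega
      · intro x hx
        rcases Finset.mem_insert.1 (Finset.mem_coe.1 hx) with rfl | hx
        · exact ht.2.1 v.2
        · exact hs.2.1 (Finset.mem_of_mem_erase hx)
  rw [dotProduct_vectorSum, dotProduct_vectorSum, ← Finset.sum_coe_sort s,
    ← Finset.sum_coe_sort t, ← e.sum_comp]
  exact Finset.sum_le_sum fun v _ => hle v

end Exchange

/-! ### Minimizers over convex hulls, Minkowski sums and the orthant -/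

section Polyhedra

variable {d : ℕ}

/-- If minimizers over `S` of `w` are minimizers of `w'`, the same is true over the convex hull
of `S`. -/
theorem minFace_convexHull_subset {S : Set (Fin d → ℝ)} {w w' : Fin d → ℝ}
    (h : minFace S w ⊆ minFace S w') :
    minFace (convexHull ℝ S) w ⊆ minFace (convexHull ℝ S) w' := by
  intro x hx
  refine ⟨hx.1, fun y hy => ?_⟩
  obtain ⟨ι, _, c, z, hc, hc1, hz, hzx⟩ := mem_convexHull_iff_exists_fintype.1 hx.1
  have hdot : ∀ w : Fin d → ℝ, w ⬝ᵥ x = ∑ i, c i * w ⬝ᵥ z i := by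
    intro w
    simp [← hzx, dotProduct_sum]
  -- Nonnegative terms with sum zero: every point of positive coefficient is itself a minimizer of
  -- `w`.
  have hterm : ∀ i, c i * (w ⬝ᵥ z i - w ⬝ᵥ x) = 0 := by
    have h0 : ∑ i, c i * (w ⬝ᵥ z i - w ⬝ᵥ x) = 0 := by
      simp_rw [mul_sub, Finset.sum_sub_distrib, ← Finset.sum_mul, hc1, ← hdot]
      ring
    intro i
    exact (Finset.sum_eq_zero_iff_of_nonneg fun i _ => mul_nonneg (hc i)
      (sub_nonneg.2 (hx.2 _ (subset_convexHull ℝ S (hz i))))).1 h0 i (Finset.mem_univ i)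
  have hlin : IsLinearMap ℝ fun u : Fin d → ℝ => w' ⬝ᵥ u :=
    ⟨dotProduct_add w', fun a u => dotProduct_smul a w' u⟩
  refine convexHull_min (t := {u | w' ⬝ᵥ x ≤ w' ⬝ᵥ u}) (fun u hu => ?_)
    (convex_halfSpace_ge hlin _) hy
  change w' ⬝ᵥ x ≤ w' ⬝ᵥ u
  calc w' ⬝ᵥ x = ∑ i, c i * w' ⬝ᵥ z i := hdot w'
    _ ≤ ∑ i, c i * w' ⬝ᵥ u := by
      refine Finset.sum_le_sum fun i _ => ?_
      rcases (hc i).eq_or_lt with h0 | hpos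
      · simp [← h0]
      · have heq : w ⬝ᵥ z i = w ⬝ᵥ x :=
          sub_eq_zero.1 ((mul_eq_zero.1 (hterm i)).resolve_left hpos.ne')
        have hzi : z i ∈ minFace S w :=
          ⟨hz i, fun v hv => heq ▸ hx.2 v (subset_convexHull ℝ S hv)⟩
        exact mul_le_mul_of_nonneg_left ((h hzi).2 u hu) (hc i)
    _ = w' ⬝ᵥ u := by rw [← Finset.sum_mul, hc1, one_mul]

/-- Varying one summand at a time shows that a minimizer over a sum splits into minimizers over the
summands. -/
theorem minFace_add_subset {A B : Set (Fin d → ℝ)} {w w' : Fin d → ℝ}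
    (hA : minFace A w ⊆ minFace A w') (hB : minFace B w ⊆ minFace B w') :
    minFace (A + B) w ⊆ minFace (A + B) w' := by
  rintro x ⟨⟨a, ha, b, hb, rfl⟩, hmin⟩
  have ha' : a ∈ minFace A w := ⟨ha, fun y hy => by
    simpa [dotProduct_add] using hmin (y + b) (Set.add_mem_add hy hb)⟩
  have hb' : b ∈ minFace B w := ⟨hb, fun y hy => by
    simpa [dotProduct_add] using hmin (a + y) (Set.add_mem_add ha hy)⟩
  refine ⟨Set.add_mem_add ha hb, ?_⟩
  rintro _ ⟨y, hy, z, hz, rfl⟩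
  simp only [dotProduct_add]
  exact add_le_add ((hA ha').2 y hy) ((hB hb').2 z hz)

/-- A minimum over the orthant forces `w ≥ 0` and complementary slackness `w i * x i = 0`; both
depend only on the signs of the `w i`. -/
theorem minFace_orthant_subset {w w' : Fin d → ℝ}
    (h : ∀ i, (w i ≤ 0 → w' i ≤ 0) ∧ (0 ≤ w i → 0 ≤ w' i)) :
    minFace {x : Fin d → ℝ | ∀ i, 0 ≤ x i} w ⊆ minFace {x : Fin d → ℝ | ∀ i, 0 ≤ x i} w' := by
  rintro x ⟨hx, hmin⟩
  have hx : ∀ i, 0 ≤ x i := hx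
  have hw : ∀ i, 0 ≤ w i := by
    intro i
    have := hmin (x + Pi.single i 1) fun j =>
      add_nonneg (hx j) (by by_cases hj : j = i <;> simp [hj])
    simpa [dotProduct_add] using this
  have hle : w ⬝ᵥ x ≤ 0 := by simpa using hmin 0 fun _ => le_rfl
  have hterm : ∀ i, w i * x i = 0 := by
    have h0 : ∑ i, w i * x i = 0 :=
      le_antisymm hle (Finset.sum_nonneg fun i _ => mul_nonneg (hw i) (hx i))
    intro i
    exact (Finset.sum_eq_zero_iff_of_nonneg fun i _ => mul_nonneg (hw i) (hx i)).1 h0 i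
      (Finset.mem_univ i)
  have hw' : ∀ i, 0 ≤ w' i := fun i => (h i).2 (hw i)
  refine ⟨hx, fun y hy => ?_⟩
  have hy : ∀ i, 0 ≤ y i := hy
  refine Finset.sum_le_sum fun i _ => ?_
  have h0 : w' i * x i = 0 := by
    rcases mul_eq_zero.1 (hterm i) with h1 | h1
    · rw [le_antisymm ((h i).1 h1.le) (hw' i), zero_mul]
    · rw [h1, mul_zero]
  rw [h0]
  exact mul_nonneg (hw' i) (hy i)

end Polyhedra

end HilbertZonotope

open HilbertZonotope
theorem theorem3p5 {F : Type*} [Field F] (d n : ℕ) (hd : 0 < d) (hn : 0 < n)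
    (I : Ideal (MvPolynomial (Fin d) F)) (hI : I ∈ HilbertZonotope.hilb F d n) :
    HilbertZonotope.IsRefinement (HilbertZonotope.hilbertZonotope d n)
        (HilbertZonotope.basisPolytope n I) ∧
      HilbertZonotope.IsRefinement (HilbertZonotope.hilbertZonotope d n)
        (HilbertZonotope.statePolyhedron n I) := by
  have hcmp : ∀ w w' : Fin d → ℝ,
      minFace (hilbertZonotope d n) w = minFace (hilbertZonotope d n) w' →
      minFace (basisPolytope n I) w ⊆ minFace (basisPolytope n I) w' ∧
        ∀ i, (w i ≤ 0 → w' i ≤ 0) ∧ (0 ≤ w i → 0 ≤ w' i) := by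
    intro w w' h
    obtain ⟨h1, h2⟩ := compare_of_directions (w := w) (w' := w') hd hn fun v hv =>
      nonpos_of_minFace_zonotope_eq _ h ((directions_finite d n).mem_toFinset.2 hv)
    refine ⟨minFace_convexHull_subset ?_, h2⟩
    rintro _ ⟨⟨s, hs, rfl⟩, hmin⟩
    refine ⟨Set.mem_image_of_mem _ hs, ?_⟩
    rintro _ ⟨t, ht, rfl⟩
    exact minimal_basicSet h1 hs (fun l hl => hmin _ (Set.mem_image_of_mem _ hl)) ht
  have hne := minFace_zonotope_nonempty (directions_finite d n).toFinset
  exact ⟨isRefinement_of_minFace hne fun w w' h => (hcmp w w' h).1,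
    isRefinement_of_minFace hne fun w w' h =>
      minFace_add_subset (hcmp w w' h).1 (minFace_orthant_subset (hcmp w w' h).2)⟩
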